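/- Let $(M,g)$ be a smooth Riemannian manifold of dimension $n$ with Levi-Civita connection $\nabla$, and let $\alpha$ be a smooth, non-negative, symmetric $2$-tensor on $TM$, i.e. $\alpha(v,v)\ge 0$ for all tangent vectors $v$. Let $\alpha^\sharp$ be the endomorphism of $TM$ defined by $g(\alpha^\sharp(v),w)=\alpha(v,w)$, let $\lambda_1\le\dots\le\lambda_n$ be its eigenvalues, counted with multiplicity, and put $G_m=\lambda_1+\dots+\lambda_m$. A lower support for $G_m$ at $x_0\in M$ is a function $\xi$ that is smooth on some open neighbourhood $U$ of $x_0$ and satisfies $\xi\le G_m$ on $U$ and $\xi(x_0)=G_m(x_0)$. Let $1\le m\le n$. Then the following two conditions are equivalent: (i) $\dim\ker\alpha^\sharp\ge m-1$ at every point of $M$; (ii) $\lambda_1\equiv\dots\equiv\lambda_{m-1}\equiv 0$ on $M$. If they hold, then for every $x_0\in M$, every lower support $\xi$ for $G_m$ at $x_0$ and every $X\in T_{x_0}M$: (1) $(\nabla_X\alpha)(v,w)=0$ for all $v,w\in\ker\alpha^\sharp(x_0)$; (2) if $\lambda_m(x_0)>0$, then $(\nabla_X\alpha)(v,w)=g(v,w)\,\nabla_X\xi(x_0)$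 for all $v,w$ in the eigenspace $E_{j(m)}=\ker(\alpha^\sharp(x_0)-\lambda_m(x_0)\,\mathrm{id})$ of $\alpha^\sharp(x_0)$ for the eigenvalue $\lambda_m(x_0)$. -/

import Mathlib

open Bundle Manifold
open scoped ContDiff

/-! ### Linear algebra of a symmetric bilinear form on a Euclidean space -/

namespace BilinForm

variable {V : Type*} [NormedAddCommGroup V] [InnerProductSpace ℝ V] [FiniteDimensional ℝ V]

/-- The endomorphism `a♯` determined by `g(a♯ v, w) = a(v, w)`, where `g` is the inner product. -/
noncomputable def sharp (a : V →L[ℝ] V →L[ℝ] ℝ) : V →ₗ[ℝ] V :=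
  haveI : CompleteSpace V := FiniteDimensional.complete ℝ V
  (InnerProductSpace.continuousLinearMapOfBilin (𝕜 := ℝ) a).toLinearMap

theorem inner_sharp (a : V →L[ℝ] V →L[ℝ] ℝ) (v w : V) :
    inner ℝ (sharp a v) w = a v w :=
  haveI : CompleteSpace V := FiniteDimensional.complete ℝ V
  InnerProductSpace.continuousLinearMapOfBilin_apply (𝕜 := ℝ) a v w

theorem sharp_isSymmetric (a : V →L[ℝ] V →L[ℝ] ℝ) (ha : ∀ v w, a v w = a w v) :
    (sharp a).IsSymmetric := fun v w => by
  rw [inner_sharp, real_inner_comm, inner_sharp, ha]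

/-- The eigenvalues `λ₁ ≤ … ≤ λₙ` of `a♯`, repeated according to multiplicity, in increasing order.
The index is shifted by one: `eigenvalue a ha hn ⟨k, _⟩` is `λ_{k+1}`. -/
noncomputable def eigenvalue (a : V →L[ℝ] V →L[ℝ] ℝ) (ha : ∀ v w, a v w = a w v) {n : ℕ}
    (hn : Module.finrank ℝ V = n) (k : Fin n) : ℝ :=
  (sharp_isSymmetric a ha).eigenvalues hn k.rev

theorem eigenvalue_mono (a : V →L[ℝ] V →L[ℝ] ℝ) (ha : ∀ v w, a v w = a w v) {n : ℕ}
    (hn : Module.finrank ℝ V = n) : Monotone (eigenvalue a ha hn) := fun _ _ h =>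
  (sharp_isSymmetric a ha).eigenvalues_antitone hn (Fin.rev_le_rev.2 h)

end BilinForm

/-! ### Symmetric 2-tensors on a Riemannian manifold -/

section Riemannian

variable {n : ℕ} {M : Type*} [TopologicalSpace M] [ChartedSpace (EuclideanSpace ℝ (Fin n)) M]

theorem finrank_tangentSpace (x : M) : Module.finrank ℝ (TangentSpace (𝓡 n) x) = n :=
  finrank_euclideanSpace_fin (𝕜 := ℝ)

instance finiteDimensional_tangentSpace (x : M) :
    FiniteDimensional ℝ (TangentSpace (𝓡 n) x) :=
  inferInstanceAs (FiniteDimensional ℝ (EuclideanSpace ℝ (Fin n)))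

/-- A smooth symmetric 2-tensor on the tangent bundle of `M`. -/
structure SymTwoTensor (n : ℕ) (M : Type*) [TopologicalSpace M]
    [ChartedSpace (EuclideanSpace ℝ (Fin n)) M] [IsManifold (𝓡 n) ∞ M] where
  /-- the bilinear form on each tangent space -/
  form : ∀ x : M, TangentSpace (𝓡 n) x →L[ℝ] TangentSpace (𝓡 n) x →L[ℝ] ℝ
  symm : ∀ (x : M) (v w : TangentSpace (𝓡 n) x), form x v w = form x w v
  smooth : ContMDiff (𝓡 n)
    ((𝓡 n).prod 𝓘(ℝ, EuclideanSpace ℝ (Fin n) →L[ℝ] EuclideanSpace ℝ (Fin n) →L[ℝ] ℝ)) ∞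
    (fun x => TotalSpace.mk'
      (EuclideanSpace ℝ (Fin n) →L[ℝ] EuclideanSpace ℝ (Fin n) →L[ℝ] ℝ)
      (E := fun x : M => TangentSpace (𝓡 n) x →L[ℝ] TangentSpace (𝓡 n) x →L[ℝ] ℝ) x (form x))

/-- `ξ` is a smooth lower support for `f` at `x₀`: on an open neighbourhood of `x₀` the function
`ξ` is smooth and `ξ ≤ f`, with equality at `x₀`. -/
def IsLowerSupport (n : ℕ) {M : Type*} [TopologicalSpace M]
    [ChartedSpace (EuclideanSpace ℝ (Fin n)) M] (f ξ : M → ℝ) (x₀ : M) : Prop :=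
  (∃ U : Set M, IsOpen U ∧ x₀ ∈ U ∧ ContMDiffOn (𝓡 n) 𝓘(ℝ) ∞ ξ U ∧ ∀ x ∈ U, ξ x ≤ f x) ∧
    ξ x₀ = f x₀

variable [IsManifold (𝓡 n) ∞ M]

namespace SymTwoTensor

/-- `α` is non-negative: `α(v, v) ≥ 0` for all tangent vectors `v`. -/
def Nonneg (α : SymTwoTensor n M) : Prop :=
  ∀ (x : M) (v : TangentSpace (𝓡 n) x), 0 ≤ α.form x v v

section Eigenvalues

variable [RiemannianBundle (fun x : M => TangentSpace (𝓡 n) x)]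

/-- The endomorphism `α♯` of `T_xM` with `g(α♯ v, w) = α(v, w)`. -/
noncomputable def sharp (α : SymTwoTensor n M) (x : M) :
    TangentSpace (𝓡 n) x →ₗ[ℝ] TangentSpace (𝓡 n) x :=
  BilinForm.sharp (α.form x)

/-- The eigenvalues `λ₁ ≤ … ≤ λₙ` of `α♯` at `x`; `α.eigenvalue x ⟨k, _⟩` is `λ_{k+1}(x)`. -/
noncomputable def eigenvalue (α : SymTwoTensor n M) (x : M) (k : Fin n) : ℝ :=
  BilinForm.eigenvalue (α.form x) (α.symm x) (finrank_tangentSpace x) k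

/-- The subtrace `G_m = λ₁ + ⋯ + λ_m` of `α♯`. -/
noncomputable def subtrace (α : SymTwoTensor n M) (m : ℕ) (x : M) : ℝ :=
  ∑ k : Fin n with k.val < m, α.eigenvalue x k

end Eigenvalues

/-! #### The covariant derivative of a symmetric 2-tensor -/

/-- The vector field `Y` is differentiable at `x`, as a section of the tangent bundle. -/
abbrev _root_.VectorFieldDiffAt (Y : ∀ y : M, TangentSpace (𝓡 n) y) (x : M) : Prop :=
  MDifferentiableAt (𝓡 n) ((𝓡 n).prod 𝓘(ℝ, EuclideanSpace ℝ (Fin n)))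
    (fun y => TotalSpace.mk' (EuclideanSpace ℝ (Fin n)) y (Y y)) x

theorem mdifferentiableAt_form (α : SymTwoTensor n M) {x : M}
    {Y Z : ∀ y : M, TangentSpace (𝓡 n) y}
    (hY : VectorFieldDiffAt Y x) (hZ : VectorFieldDiffAt Z x) :
    MDifferentiableAt (𝓡 n) 𝓘(ℝ) (fun y => α.form y (Y y) (Z y)) x := by
  have h : MDifferentiableAt (𝓡 n) ((𝓡 n).prod 𝓘(ℝ, ℝ))
      (fun y => TotalSpace.mk' ℝ (E := Bundle.Trivial M ℝ) y (α.form y (Y y) (Z y))) x := by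
    apply MDifferentiableAt.clm_bundle_apply₂ (F₁ := EuclideanSpace ℝ (Fin n))
      (F₂ := EuclideanSpace ℝ (Fin n))
    · exact (α.smooth x).mdifferentiableAt (by simp)
    · exact hY
    · exact hZ
  simp only [mdifferentiableAt_totalSpace] at h
  exact h.2

/-- The linear form `X ↦ X(α(Y, Z)) - α(∇_X Y, Z) - α(Y, ∇_X Z)` on `T_xM`. -/
noncomputable def nablaAux (α : SymTwoTensor n M)
    (cov : CovariantDerivative (𝓡 n) (EuclideanSpace ℝ (Fin n))
      (fun x : M => TangentSpace (𝓡 n) x))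
    (Y Z : ∀ y : M, TangentSpace (𝓡 n) y) (x : M) : TangentSpace (𝓡 n) x →L[ℝ] ℝ :=
  mvfderiv (𝓡 n) (fun y => α.form y (Y y) (Z y)) x
    - (α.form x (Z x)).comp (cov Y x) - (α.form x (Y x)).comp (cov Z x)

theorem nablaAux_comm (α : SymTwoTensor n M)
    (cov : CovariantDerivative (𝓡 n) (EuclideanSpace ℝ (Fin n))
      (fun x : M => TangentSpace (𝓡 n) x))
    (Y Z : ∀ y : M, TangentSpace (𝓡 n) y) (x : M) :
    α.nablaAux cov Y Z x = α.nablaAux cov Z Y x := by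
  have h : (fun y => α.form y (Y y) (Z y)) = fun y => α.form y (Z y) (Y y) :=
    funext fun y => α.symm y _ _
  rw [nablaAux, nablaAux, h]
  abel

theorem nablaAux_tensorial (α : SymTwoTensor n M)
    (cov : CovariantDerivative (𝓡 n) (EuclideanSpace ℝ (Fin n))
      (fun x : M => TangentSpace (𝓡 n) x))
    (Z : ∀ y : M, TangentSpace (𝓡 n) y) {x : M} (hZ : VectorFieldDiffAt Z x) :
    TensorialAt (𝓡 n) (EuclideanSpace ℝ (Fin n)) (fun Y => α.nablaAux cov Y Z x) x where
  smul {f Y} hf hY := by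
    have h : (fun y => α.form y ((f • Y) y) (Z y)) = fun y => f y * α.form y (Y y) (Z y) := by
      funext y; simp
    ext X
    simp only [nablaAux, h]
    simp [mvfderiv_fun_mul hf (α.mdifferentiableAt_form hY hZ),
      cov.isCovariantDerivativeOn.leibniz hY hf, α.symm x (Z x) (Y x)]
    ring
  add {Y Y'} hY hY' := by
    have h : (fun y => α.form y ((Y + Y') y) (Z y))
        = fun y => α.form y (Y y) (Z y) + α.form y (Y' y) (Z y) := by
      funext y; simp
    ext X
    simp only [nablaAux, h]
    simp [mvfderiv_fun_add (α.mdifferentiableAt_form hY hZ) (α.mdifferentiableAt_form hY' hZ),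
      cov.isCovariantDerivativeOn.add hY hY']
    abel

theorem nablaAux_tensorial' (α : SymTwoTensor n M)
    (cov : CovariantDerivative (𝓡 n) (EuclideanSpace ℝ (Fin n))
      (fun x : M => TangentSpace (𝓡 n) x))
    (Y : ∀ y : M, TangentSpace (𝓡 n) y) {x : M} (hY : VectorFieldDiffAt Y x) :
    TensorialAt (𝓡 n) (EuclideanSpace ℝ (Fin n)) (fun Z => α.nablaAux cov Y Z x) x := by
  simp only [fun Z => α.nablaAux_comm cov Y Z x]
  exact α.nablaAux_tensorial cov Y hY

/-- The covariant derivative `∇α` at `x`: `α.nabla cov x v w X` is `(∇_X α)(v, w)`. -/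
noncomputable def nabla (α : SymTwoTensor n M)
    (cov : CovariantDerivative (𝓡 n) (EuclideanSpace ℝ (Fin n))
      (fun x : M => TangentSpace (𝓡 n) x)) (x : M) :
    TangentSpace (𝓡 n) x →L[ℝ] TangentSpace (𝓡 n) x →L[ℝ] TangentSpace (𝓡 n) x →L[ℝ] ℝ :=
  TensorialAt.mkHom₂ (fun Y Z => α.nablaAux cov Y Z x) x
    (fun Z hZ => α.nablaAux_tensorial cov Z hZ) (fun Y hY => α.nablaAux_tensorial' cov Y hY)

/-- The Leibniz formula `(∇_X α)(Y, Z) = X(α(Y, Z)) - α(∇_X Y, Z) - α(Y, ∇_X Z)` for all vector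
fields `Y`, `Z` that are differentiable at `x`. -/
theorem nabla_apply (α : SymTwoTensor n M)
    (cov : CovariantDerivative (𝓡 n) (EuclideanSpace ℝ (Fin n))
      (fun x : M => TangentSpace (𝓡 n) x)) {x : M}
    {Y Z : ∀ y : M, TangentSpace (𝓡 n) y}
    (hY : VectorFieldDiffAt Y x) (hZ : VectorFieldDiffAt Z x)
    (X : TangentSpace (𝓡 n) x) :
    α.nabla cov x (Y x) (Z x) X =
      mvfderiv (𝓡 n) (fun y => α.form y (Y y) (Z y)) x X
        - α.form x (cov Y x X) (Z x) - α.form x (Y x) (cov Z x X) := by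
  rw [nabla, TensorialAt.mkHom₂_apply _ _ hY hZ, nablaAux, α.symm x (cov Y x X) (Z x)]
  rfl

end SymTwoTensor

/-- `cov` is the Levi-Civita connection of the Riemannian metric of `M`: it is torsion-free and
compatible with the metric. -/
def IsLeviCivita [RiemannianBundle (fun x : M => TangentSpace (𝓡 n) x)]
    [IsContMDiffRiemannianBundle (𝓡 n) ∞ (EuclideanSpace ℝ (Fin n))
      (fun x : M => TangentSpace (𝓡 n) x)]
    (cov : CovariantDerivative (𝓡 n) (EuclideanSpace ℝ (Fin n))
      (fun x : M => TangentSpace (𝓡 n) x)) : Prop :=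
  haveI : IsContMDiffRiemannianBundle (𝓡 n) 1 (EuclideanSpace ℝ (Fin n))
      (fun x : M => TangentSpace (𝓡 n) x) := .of_le (n := ∞) (by simp)
  cov.torsion = 0 ∧ cov.IsMetricCompatible

end Riemannian

/-!
For a non-negative symmetric form `a` the number of vanishing eigenvalues is `dim ker a♯`, and the
eigenvalues are ordered and non-negative, so the two forms of the rank hypothesis agree
(`BilinForm.le_finrank_ker_sharp_iff`). Under this hypothesis `G_m = λ_m`.

Both formulas for `∇α` are first order conditions at a local minimum, and by polarization it is
enough to compute `(∇_X α)(v, v)`. Extend `v` to a vector field `Y`. If `v` lies in the kernel of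
`α♯`, then `α(Y, Y) ≥ 0` has a minimum at `x₀`, and the terms `α(∇_X Y, v)` vanish
(`SymTwoTensor.nabla_self_eq_zero`).

Now let `v` be an eigenvector for `μ = λ_m(x₀) > 0`. The function `α(Y, Y) - ξ g(Y, Y)` vanishes at
`x₀`, but it need not be non-negative, since `Y` may acquire a component in the kernel of `α♯` away
from `x₀`. Let `P` be the orthogonal projection onto the span of eigenvectors for the first `m - 1`
eigenvalues, which lie in the kernel. Then `μ P Y = P (μ Y - α♯ Y)`, so this component is bounded by
the defect `μ Y - α♯ Y`, and
`λ_m (μ² |Y|² - |μ Y - α♯ Y|²) ≤ μ² α(Y, Y)` (`BilinForm.eigenvalue_mul_sub_le`). The defect vanishes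
at `x₀`, and its squared norm is at most a constant times the sum of the squares of its inner
products with a local frame (`exists_frame_norm_sq_le`). This sum is differentiable and vanishes to
first order at `x₀`. Hence `α(Y, Y) - ξ g(Y, Y)` plus an error with vanishing derivative has a
local minimum at `x₀`, and metric compatibility of the connection cancels the terms containing
`∇_X Y` (`SymTwoTensor.nabla_self_eq_of_mem_eigenspace`). No orthonormal frames and no
differentiability of eigenvalues or eigenvectors are needed.
-/

/-! ### Small eigenvalues of a positive semidefinite form -/

namespace BilinForm

variable {V : Type*} [NormedAddCommGroup V] [InnerProductSpace ℝ V] [FiniteDimensional ℝ V]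

theorem eigenvalue_nonneg (a : V →L[ℝ] V →L[ℝ] ℝ) (ha : ∀ v w, a v w = a w v)
    (hpos : ∀ v, 0 ≤ a v v) {n : ℕ} (hn : Module.finrank ℝ V = n) (k : Fin n) :
    0 ≤ eigenvalue a ha hn k := by
  refine eigenvalue_nonneg_of_nonneg ((sharp_isSymmetric a ha).hasEigenvalue_eigenvalues hn k.rev)
    fun v => ?_
  rw [real_inner_comm, inner_sharp]
  exact hpos v

theorem card_eigenvalue_eq_zero (a : V →L[ℝ] V →L[ℝ] ℝ) (ha : ∀ v w, a v w = a w v) {n : ℕ}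
    (hn : Module.finrank ℝ V = n) :
    Finset.card {k : Fin n | eigenvalue a ha hn k = 0}
      = Module.finrank ℝ (LinearMap.ker (sharp a)) := by
  rw [← Module.End.eigenspace_zero,
    ← (sharp_isSymmetric a ha).card_filter_eigenvalues_eq hn 0]
  exact Finset.card_equiv Fin.revPerm fun k => by
    simp only [Finset.mem_filter_univ]
    rfl

theorem le_finrank_ker_sharp_iff (a : V →L[ℝ] V →L[ℝ] ℝ) (ha : ∀ v w, a v w = a w v)
    (hpos : ∀ v, 0 ≤ a v v) {n : ℕ} (hn : Module.finrank ℝ V = n) {p : ℕ} (hp : p ≤ n) :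
    p ≤ Module.finrank ℝ (LinearMap.ker (sharp a)) ↔
      ∀ k : Fin n, k.val < p → eigenvalue a ha hn k = 0 := by
  rw [← card_eigenvalue_eq_zero a ha hn]
  constructor
  · intro h k hk
    by_contra hne
    have hlt : 0 < eigenvalue a ha hn k :=
      lt_of_le_of_ne (eigenvalue_nonneg a ha hpos hn k) (Ne.symm hne)
    have hsub : ({j : Fin n | eigenvalue a ha hn j = 0} : Finset (Fin n)) ⊆ Finset.Iio k := by
      intro j hj
      simp only [Finset.mem_filter_univ] at hj
      rw [Finset.mem_Iio]
      by_contra hkj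
      exact absurd (eigenvalue_mono a ha hn (not_lt.1 hkj)) (by rw [hj]; exact not_le.2 hlt)
    have := Finset.card_le_card hsub
    rw [Fin.card_Iio] at this
    omega
  · intro h
    calc p = (Finset.univ.map (Fin.castLEEmb hp)).card := by simp
      _ ≤ _ := Finset.card_le_card fun j hj => by
        obtain ⟨i, -, rfl⟩ := Finset.mem_map.1 hj
        exact Finset.mem_filter_univ _ |>.2 (h _ i.isLt)

/-- A substitute for the Rayleigh quotient bound `λ ‖u‖² ≤ a(u, u)`, which only holds for `u`
orthogonal to the eigenvectors of the preceding eigenvalues. If these vanish, the component of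
`u` on the kernel is controlled by the defect `μ u - a♯ u`, and the error is quadratic in this
defect. -/
theorem eigenvalue_mul_sub_le (a : V →L[ℝ] V →L[ℝ] ℝ) (ha : ∀ v w, a v w = a w v)
    {n : ℕ} (hn : Module.finrank ℝ V = n) (p : Fin n)
    (hp : 0 ≤ eigenvalue a ha hn p) (h0 : ∀ k < p, eigenvalue a ha hn k = 0) (μ : ℝ) (u : V) :
    eigenvalue a ha hn p * (μ ^ 2 * ‖u‖ ^ 2 - ‖μ • u - sharp a u‖ ^ 2) ≤ μ ^ 2 * a u u := by
  set hT := sharp_isSymmetric a ha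
  set b := hT.eigenvectorBasis hn
  have hrepr (i : Fin n) : b.repr (sharp a u) i = hT.eigenvalues hn i * b.repr u i :=
    hT.eigenvectorBasis_apply_self_apply hn u i
  have h1 : ‖u‖ ^ 2 = ∑ i, b.repr u i ^ 2 := by
    rw [← b.repr.norm_map, EuclideanSpace.real_norm_sq_eq]
  have h2 : ‖μ • u - sharp a u‖ ^ 2 = ∑ i, ((μ - hT.eigenvalues hn i) * b.repr u i) ^ 2 := by
    rw [← b.repr.norm_map, EuclideanSpace.real_norm_sq_eq]
    refine Finset.sum_congr rfl fun i _ => ?_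
    simp only [map_sub, map_smul, PiLp.sub_apply, PiLp.smul_apply, hrepr, smul_eq_mul]
    ring
  have h3 : a u u = ∑ i, hT.eigenvalues hn i * b.repr u i ^ 2 := by
    rw [← inner_sharp, ← b.repr.inner_map_map, PiLp.inner_apply]
    refine Finset.sum_congr rfl fun i _ => ?_
    simp only [hrepr, RCLike.inner_apply, conj_trivial]
    ring
  rw [h1, h2, h3, Finset.mul_sum, Finset.mul_sum, ← Finset.sum_sub_distrib, Finset.mul_sum]
  refine Finset.sum_le_sum fun i _ => ?_
  have hi : hT.eigenvalues hn i = eigenvalue a ha hn i.rev := by simp [eigenvalue]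
  rw [hi]
  -- every eigenvalue is either `0` or at least the one with index `p`
  rcases lt_or_ge i.rev p with hlt | hge
  · rw [h0 _ hlt]
    apply le_of_eq
    ring
  · have hle := eigenvalue_mono a ha hn hge
    have e1 := mul_le_mul_of_nonneg_right hle
      (mul_nonneg (sq_nonneg μ) (sq_nonneg (b.repr u i)))
    have e2 := mul_nonneg hp (sq_nonneg ((μ - eigenvalue a ha hn i.rev) * b.repr u i))
    linarith

end BilinForm

/-! ### First order conditions on a Riemannian manifold -/

section Riemannian

variable {n : ℕ} {M : Type*} [TopologicalSpace M] [ChartedSpace (EuclideanSpace ℝ (Fin n)) M]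

theorem mvfderiv_eq_zero_of_isLocalMin {f : M → ℝ} {x : M} (hf : IsLocalMin f x) :
    mvfderiv (𝓡 n) f x = 0 := by
  by_cases hd : MDifferentiableAt (𝓡 n) 𝓘(ℝ) f x
  · have hcont := (continuousAt_extChartAt_symm (I := 𝓡 n) x).tendsto
    rw [extChartAt_to_inv] at hcont
    have hmin : IsLocalMin (writtenInExtChartAt (𝓡 n) 𝓘(ℝ) x f) (extChartAt (𝓡 n) x x) := by
      filter_upwards [hcont.eventually hf] with y hy
      simpa only [writtenInExtChartAt, extChartAt_model_space_eq_id, PartialEquiv.refl_coe,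
        Function.comp_apply, id_eq, extChartAt_to_inv] using hy
    have h0 : mfderiv (𝓡 n) 𝓘(ℝ) f x = 0 := by
      rw [hd.mfderiv]
      rw [modelWithCornersSelf_coe, Set.range_id, fderivWithin_univ]
      exact hmin.fderiv_eq_zero
    simp [mvfderiv, h0]
  · simp [mvfderiv, mfderiv_zero_of_not_mdifferentiableAt hd]

/-- At a local minimum of `A - ξ B` with the error term `H` vanishing to first order, the product
rule determines the derivative of `A`. The constants `μ` and `C` are harmless normalizations. -/
theorem mvfderiv_eq_of_isLocalMin {A B H ξ : M → ℝ} {x : M}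
    (hA : MDifferentiableAt (𝓡 n) 𝓘(ℝ) A x) (hB : MDifferentiableAt (𝓡 n) 𝓘(ℝ) B x)
    (hH : MDifferentiableAt (𝓡 n) 𝓘(ℝ) H x) (hξ : MDifferentiableAt (𝓡 n) 𝓘(ℝ) ξ x)
    (hHx : H x = 0) (hdH : mvfderiv (𝓡 n) H x = 0) {μ C : ℝ} (hμ : μ ≠ 0)
    (hmin : IsLocalMin (fun y => μ ^ 2 * A y - ξ y * (μ ^ 2 * B y - C * H y)) x)
    (X : TangentSpace (𝓡 n) x) :
    mvfderiv (𝓡 n) A x X = B x * mvfderiv (𝓡 n) ξ x X + ξ x * mvfderiv (𝓡 n) B x X := by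
  have hc (c : ℝ) : MDifferentiableAt (𝓡 n) 𝓘(ℝ) (fun _ : M => c) x := mdifferentiableAt_const
  have hd := congrArg (fun D => D X) (mvfderiv_eq_zero_of_isLocalMin hmin)
  have hA' : MDifferentiableAt (𝓡 n) 𝓘(ℝ) (fun y => μ ^ 2 * A y) x := (hc _).mul hA
  have hB' : MDifferentiableAt (𝓡 n) 𝓘(ℝ) (fun y => μ ^ 2 * B y) x := (hc _).mul hB
  have hH' : MDifferentiableAt (𝓡 n) 𝓘(ℝ) (fun y => C * H y) x := (hc _).mul hH
  have hBH : MDifferentiableAt (𝓡 n) 𝓘(ℝ) (fun y => μ ^ 2 * B y - C * H y) x := hB'.sub hH'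
  have hξBH : MDifferentiableAt (𝓡 n) 𝓘(ℝ) (fun y => ξ y * (μ ^ 2 * B y - C * H y)) x :=
    hξ.mul hBH
  rw [mvfderiv_fun_sub hA' hξBH, mvfderiv_fun_mul (hc _) hA, mvfderiv_fun_mul hξ hBH,
    mvfderiv_fun_sub hB' hH', mvfderiv_fun_mul (hc _) hB, mvfderiv_fun_mul (hc _) hH, hdH] at hd
  simp [mvfderiv_const, hHx] at hd
  apply mul_left_cancel₀ (pow_ne_zero 2 hμ)
  linarith

variable [IsManifold (𝓡 n) ∞ M] [RiemannianBundle (fun x : M => TangentSpace (𝓡 n) x)]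

theorem isContinuousRiemannianBundle_tangentSpace
    [h : IsContMDiffRiemannianBundle (𝓡 n) ∞ (EuclideanSpace ℝ (Fin n))
      (fun x : M => TangentSpace (𝓡 n) x)] :
    IsContinuousRiemannianBundle (EuclideanSpace ℝ (Fin n))
      (fun x : M => TangentSpace (𝓡 n) x) := by
  obtain ⟨g, hg, hgi⟩ := h.exists_contMDiff
  exact ⟨⟨g, hg.continuous, hgi⟩⟩

variable [IsContMDiffRiemannianBundle (𝓡 n) ∞ (EuclideanSpace ℝ (Fin n))
    (fun x : M => TangentSpace (𝓡 n) x)]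

/-- Near a point, the norm of a tangent vector is controlled by its inner products with a frame of
smooth vector fields. -/
theorem exists_frame_norm_sq_le (x : M) :
    ∃ (Y : Fin n → ∀ y : M, TangentSpace (𝓡 n) y) (C : ℝ),
      (∀ i, VectorFieldDiffAt (Y i) x) ∧
      ∀ᶠ y in nhds x, ∀ u : TangentSpace (𝓡 n) y,
        ‖u‖ ^ 2 ≤ C * ∑ i, (inner ℝ u (Y i y)) ^ 2 := by
  have := isContinuousRiemannianBundle_tangentSpace (n := n) (M := M)
  set e := trivializationAt (EuclideanSpace ℝ (Fin n)) (fun x : M => TangentSpace (𝓡 n) x) x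
  set b := (EuclideanSpace.basisFun (Fin n) ℝ).toBasis
  have hx : x ∈ e.baseSet := FiberBundle.mem_baseSet_trivializationAt' x
  obtain ⟨C, hC0, hC⟩ := eventually_norm_trivializationAt_lt (EuclideanSpace ℝ (Fin n))
    (fun x : M => TangentSpace (𝓡 n) x) x
  refine ⟨e.localFrame b, C ^ 2, fun i => ?_, ?_⟩
  · exact (contMDiffAt_localFrame_of_mem 1 e b i hx).mdifferentiableAt (by simp)
  filter_upwards [hC, e.open_baseSet.mem_nhds hx] with y hy hyb u
  set c := e.continuousLinearMapAt ℝ y u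
  have hc : ‖c‖ ≤ C * ‖u‖ := (e.continuousLinearMapAt ℝ y).le_of_opNorm_le hy.le u
  have hu : u = ∑ i, c i • e.localFrame b i y := by
    conv_lhs => rw [← (e.basisAt b hyb).sum_repr u]
    refine Finset.sum_congr rfl fun i _ => ?_
    rw [e.localFrame_apply_of_mem_baseSet b hyb]
    congr 1
    simp [Trivialization.basisAt, b, c, hyb]
  -- `‖u‖²` is the sum of coordinates times inner products; apply the Cauchy-Schwarz inequality
  set s := ∑ i, (inner ℝ u (e.localFrame b i y)) ^ 2
  have hs : 0 ≤ s := Finset.sum_nonneg fun i _ => sq_nonneg _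
  have h1 : ‖u‖ ^ 2 = ∑ i, c i * inner ℝ u (e.localFrame b i y) := by
    rw [← real_inner_self_eq_norm_sq]
    nth_rewrite 2 [hu]
    simp only [inner_sum, real_inner_smul_right]
  have h2 : (‖u‖ ^ 2) ^ 2 ≤ ‖c‖ ^ 2 * s := by
    rw [h1, EuclideanSpace.real_norm_sq_eq]
    exact Finset.sum_mul_sq_le_sq_mul_sq _ _ _
  have h3 : ‖c‖ ^ 2 ≤ C ^ 2 * ‖u‖ ^ 2 := by
    rw [← mul_pow]
    gcongr
  rcases (sq_nonneg ‖u‖).eq_or_lt with h0 | h0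
  · rw [← h0]; positivity
  · have := h2.trans (mul_le_mul_of_nonneg_right h3 hs)
    exact le_of_mul_le_mul_left (by linarith) h0

end Riemannian

/-! ### The covariant derivative on eigenspaces -/

section Riemannian

variable {n : ℕ} {M : Type*} [TopologicalSpace M] [ChartedSpace (EuclideanSpace ℝ (Fin n)) M]
  [IsManifold (𝓡 n) ∞ M]

theorem vectorFieldDiffAt_extend {x : M} (v : TangentSpace (𝓡 n) x) :
    VectorFieldDiffAt (FiberBundle.extend (EuclideanSpace ℝ (Fin n)) v) x :=
  FiberBundle.mdifferentiableAt_extend (𝓡 n) (EuclideanSpace ℝ (Fin n)) v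

namespace SymTwoTensor

theorem nabla_comm (α : SymTwoTensor n M)
    (cov : CovariantDerivative (𝓡 n) (EuclideanSpace ℝ (Fin n))
      (fun x : M => TangentSpace (𝓡 n) x)) (x : M) (v w : TangentSpace (𝓡 n) x) :
    α.nabla cov x v w = α.nabla cov x w v := by
  simp only [nabla, TensorialAt.mkHom₂_apply_eq_extend]
  exact α.nablaAux_comm cov _ _ x

set_option synthInstance.maxHeartbeats 200000 in
theorem nabla_add_add (α : SymTwoTensor n M)
    (cov : CovariantDerivative (𝓡 n) (EuclideanSpace ℝ (Fin n))
      (fun x : M => TangentSpace (𝓡 n) x)) (x : M) (v w X : TangentSpace (𝓡 n) x) :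
    α.nabla cov x (v + w) (v + w) X
      = α.nabla cov x v v X + 2 * α.nabla cov x v w X + α.nabla cov x w w X := by
  simp only [map_add, add_apply, α.nabla_comm cov x w v]
  ring

/-- A vector in the kernel of a non-negative form stays a minimum of `α(Y, Y)` under every
extension `Y`, so that the derivative of `α(Y, Y)` vanishes. -/
theorem nabla_self_eq_zero (α : SymTwoTensor n M) (hα : α.Nonneg)
    (cov : CovariantDerivative (𝓡 n) (EuclideanSpace ℝ (Fin n))
      (fun x : M => TangentSpace (𝓡 n) x)) {x : M} {v : TangentSpace (𝓡 n) x}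
    (hv : ∀ w, α.form x v w = 0) (X : TangentSpace (𝓡 n) x) :
    α.nabla cov x v v X = 0 := by
  set Y := FiberBundle.extend (EuclideanSpace ℝ (Fin n)) v
  have hY : VectorFieldDiffAt Y x := vectorFieldDiffAt_extend v
  have hYx : Y x = v := FiberBundle.extend_apply_self _ v
  have hmin : IsLocalMin (fun y => α.form y (Y y) (Y y)) x :=
    Filter.Eventually.of_forall fun y => by
      change α.form x (Y x) (Y x) ≤ _
      rw [hYx, hv]
      exact hα y _
  have h := α.nabla_apply cov hY hY X
  rw [mvfderiv_eq_zero_of_isLocalMin hmin, hYx, α.symm x _ v, hv] at h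
  simpa using h

section Eigenvalues

variable [RiemannianBundle (fun x : M => TangentSpace (𝓡 n) x)]

theorem le_finrank_ker_sharp_iff (α : SymTwoTensor n M) (hα : α.Nonneg) (x : M) {p : ℕ}
    (hp : p ≤ n) :
    p ≤ Module.finrank ℝ (LinearMap.ker (α.sharp x)) ↔
      ∀ k : Fin n, k.val < p → α.eigenvalue x k = 0 :=
  BilinForm.le_finrank_ker_sharp_iff (α.form x) (α.symm x) (hα x) (finrank_tangentSpace x) hp

theorem form_eq_of_mem_eigenspace (α : SymTwoTensor n M) {x : M} {μ : ℝ}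
    {v : TangentSpace (𝓡 n) x} (hv : v ∈ Module.End.eigenspace (α.sharp x) μ)
    (w : TangentSpace (𝓡 n) x) : α.form x v w = μ * inner ℝ v w := by
  rw [← BilinForm.inner_sharp, ← real_inner_smul_left, ← Module.End.mem_eigenspace_iff.1 hv]
  rfl

theorem subtrace_eq_eigenvalue (α : SymTwoTensor n M) {x : M} {m : ℕ} {p : Fin n}
    (hp : p.val + 1 = m) (h0 : ∀ k < p, α.eigenvalue x k = 0) :
    α.subtrace m x = α.eigenvalue x p := by
  refine Finset.sum_eq_single_of_mem _ (by simp; omega) fun k hk hne => h0 k ?_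
  rw [Finset.mem_filter_univ] at hk
  have : k.val ≠ p.val := fun h => hne (Fin.ext h)
  rw [Fin.lt_def]
  omega

variable [IsContMDiffRiemannianBundle (𝓡 n) ∞ (EuclideanSpace ℝ (Fin n))
    (fun x : M => TangentSpace (𝓡 n) x)]

theorem _root_.IsLeviCivita.mvfderiv_inner_self
    {cov : CovariantDerivative (𝓡 n) (EuclideanSpace ℝ (Fin n))
      (fun x : M => TangentSpace (𝓡 n) x)} (hcov : IsLeviCivita cov) {x : M}
    {Y : ∀ y : M, TangentSpace (𝓡 n) y} (hY : VectorFieldDiffAt Y x)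
    (X : TangentSpace (𝓡 n) x) :
    mvfderiv (𝓡 n) (fun y => (inner ℝ (Y y) (Y y) : ℝ)) x X
      = 2 * inner ℝ (Y x) (cov Y x X) := by
  have : IsContMDiffRiemannianBundle (𝓡 n) 1 (EuclideanSpace ℝ (Fin n))
      (fun x : M => TangentSpace (𝓡 n) x) := .of_le (n := ∞) (by simp)
  have h := hcov.2.mvfderiv_inner_eq (FiberBundle.extend (EuclideanSpace ℝ (Fin n)) X) hY hY
  simp only [FiberBundle.extend_apply_self] at h
  rw [h, real_inner_comm]
  ring

/-- If the eigenvalues preceding `λ_p` vanish identically and `ξ` supports `λ_p` from below at `x`,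
then `α(Y, Y) - ξ g(Y, Y)`, corrected by a quadratic error term, has a local minimum at `x` for
every extension `Y` of an eigenvector. -/
theorem nabla_self_eq_of_mem_eigenspace (α : SymTwoTensor n M) (hα : α.Nonneg)
    {cov : CovariantDerivative (𝓡 n) (EuclideanSpace ℝ (Fin n))
      (fun x : M => TangentSpace (𝓡 n) x)} (hcov : IsLeviCivita cov) (p : Fin n)
    (h0 : ∀ (y : M), ∀ k < p, α.eigenvalue y k = 0) {x : M} {ξ : M → ℝ}
    (hξ : MDifferentiableAt (𝓡 n) 𝓘(ℝ) ξ x) (hle : ∀ᶠ y in nhds x, ξ y ≤ α.eigenvalue y p)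
    (heq : ξ x = α.eigenvalue x p) (hpos : 0 < α.eigenvalue x p) {v : TangentSpace (𝓡 n) x}
    (hv : v ∈ Module.End.eigenspace (α.sharp x) (α.eigenvalue x p)) (X : TangentSpace (𝓡 n) x) :
    α.nabla cov x v v X = inner ℝ v v * mvfderiv (𝓡 n) ξ x X := by
  have : IsContMDiffRiemannianBundle (𝓡 n) 1 (EuclideanSpace ℝ (Fin n))
      (fun x : M => TangentSpace (𝓡 n) x) := .of_le (n := ∞) (by simp)
  set μ := α.eigenvalue x p
  set Y := FiberBundle.extend (EuclideanSpace ℝ (Fin n)) v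
  have hY : VectorFieldDiffAt Y x := vectorFieldDiffAt_extend v
  have hYx : Y x = v := FiberBundle.extend_apply_self _ v
  have hform := α.form_eq_of_mem_eigenspace hv
  obtain ⟨Z, C, hZ, hC⟩ := exists_frame_norm_sq_le (n := n) x
  -- a multiple of `H` bounds the squared norm of the defect `μ Y - α♯ Y`; its differentiability at
  -- `x` does not require that of `α♯`
  set A : M → ℝ := fun y => α.form y (Y y) (Y y)
  set B : M → ℝ := fun y => inner ℝ (Y y) (Y y)
  set h : Fin n → M → ℝ := fun i y => μ * inner ℝ (Y y) (Z i y) - α.form y (Y y) (Z i y)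
  set H : M → ℝ := fun y => ∑ i, h i y ^ 2
  have hA : MDifferentiableAt (𝓡 n) 𝓘(ℝ) A x := α.mdifferentiableAt_form hY hY
  have hB : MDifferentiableAt (𝓡 n) 𝓘(ℝ) B x := hY.inner_bundle hY
  have hh (i : Fin n) : MDifferentiableAt (𝓡 n) 𝓘(ℝ) (h i) x :=
    (mdifferentiableAt_const.mul (hY.inner_bundle (hZ i))).sub
      (α.mdifferentiableAt_form hY (hZ i))
  have hH : MDifferentiableAt (𝓡 n) 𝓘(ℝ) H x := by
    have : H = ∑ i, fun y => h i y ^ 2 := by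
      ext y
      simp [H]
    rw [this]
    exact MDifferentiableAt.sum fun i _ => (hh i).pow 2
  have hHx : H x = 0 := Finset.sum_eq_zero fun i _ => by simp [h, hYx, hform]
  have hAx : A x = μ * B x := by simp [A, B, hYx, hform]
  have hdH : mvfderiv (𝓡 n) H x = 0 := mvfderiv_eq_zero_of_isLocalMin <|
    Filter.Eventually.of_forall fun y => by
      rw [hHx]
      exact Finset.sum_nonneg fun i _ => sq_nonneg _
  have hξpos : ∀ᶠ y in nhds x, 0 < ξ y :=
    hξ.continuousAt.eventually_const_lt (by rwa [heq])
  have hmin : IsLocalMin (fun y => μ ^ 2 * A y - ξ y * (μ ^ 2 * B y - C * H y)) x := by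
    filter_upwards [hle, hC, hξpos] with y hy hCy hξy
    rw [hHx, hAx, heq]
    have key := BilinForm.eigenvalue_mul_sub_le (α.form y) (α.symm y) (finrank_tangentSpace y) p
      (hξy.le.trans hy) (h0 y) μ (Y y)
    have hr : ‖μ • Y y - α.sharp y (Y y)‖ ^ 2 ≤ C * H y := by
      refine (hCy _).trans_eq ?_
      simp only [inner_sub_left, real_inner_smul_left, H, h]
      congr 1
      refine Finset.sum_congr rfl fun i _ => ?_
      rw [← BilinForm.inner_sharp]
      rfl
    have hBy : B y = ‖Y y‖ ^ 2 := real_inner_self_eq_norm_sq _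
    have hbd : ξ y * (μ ^ 2 * B y - C * H y) ≤ μ ^ 2 * A y := by
      rcases le_total (μ ^ 2 * B y - C * H y) 0 with hneg | hnn
      · exact (mul_nonpos_of_nonneg_of_nonpos hξy.le hneg).trans
          (mul_nonneg (sq_nonneg μ) (hα y _))
      · refine (mul_le_mul hy ?_ hnn (hξy.le.trans hy)).trans key
        rw [hBy]
        exact sub_le_sub_left hr _
    linarith
  have hd := mvfderiv_eq_of_isLocalMin hA hB hH hξ hHx hdH hpos.ne' hmin X
  have hdB : mvfderiv (𝓡 n) B x X = 2 * inner ℝ v (cov Y x X) := by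
    rw [← hYx]
    exact hcov.mvfderiv_inner_self hY X
  have hN := α.nabla_apply cov hY hY X
  rw [hYx, α.symm x _ v, hform] at hN
  have hBx : B x = inner ℝ v v := by simp only [B, hYx]
  rw [hdB, heq, hBx] at hd
  change _ = mvfderiv (𝓡 n) A x X - _ - _ at hN
  rw [hN, hd]
  ring

end Eigenvalues

end SymTwoTensor

end Riemannian

theorem mainTheorem10 {n : ℕ} {M : Type*} [TopologicalSpace M]
    [ChartedSpace (EuclideanSpace ℝ (Fin n)) M] [IsManifold (𝓡 n) ∞ M]
    [RiemannianBundle (fun x : M => TangentSpace (𝓡 n) x)]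
    [IsContMDiffRiemannianBundle (𝓡 n) ∞ (EuclideanSpace ℝ (Fin n))
      (fun x : M => TangentSpace (𝓡 n) x)]
    (cov : CovariantDerivative (𝓡 n) (EuclideanSpace ℝ (Fin n))
      (fun x : M => TangentSpace (𝓡 n) x))
    (hcov : IsLeviCivita cov)
    (α : SymTwoTensor n M) (hα : α.Nonneg)
    (m : ℕ) (hm : 1 ≤ m) (hmn : m ≤ n) :
    -- the two forms of the rank hypothesis are equivalent
    ((∀ x : M, m - 1 ≤ Module.finrank ℝ (LinearMap.ker (α.sharp x))) ↔
      ∀ (x : M) (k : Fin n), k.val < m - 1 → α.eigenvalue x k = 0) ∧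
    -- and under this hypothesis `∇α` has the stated form
    ((∀ x : M, m - 1 ≤ Module.finrank ℝ (LinearMap.ker (α.sharp x))) →
      ∀ (x₀ : M) (ξ : M → ℝ), IsLowerSupport n (α.subtrace m) ξ x₀ →
        (∀ X : TangentSpace (𝓡 n) x₀,
          ∀ v ∈ LinearMap.ker (α.sharp x₀), ∀ w ∈ LinearMap.ker (α.sharp x₀),
            α.nabla cov x₀ v w X = 0) ∧
        (0 < α.eigenvalue x₀ ⟨m - 1, by omega⟩ →
          ∀ X : TangentSpace (𝓡 n) x₀,
            ∀ v ∈ Module.End.eigenspace (α.sharp x₀) (α.eigenvalue x₀ ⟨m - 1, by omega⟩),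
            ∀ w ∈ Module.End.eigenspace (α.sharp x₀) (α.eigenvalue x₀ ⟨m - 1, by omega⟩),
              α.nabla cov x₀ v w X = inner ℝ v w * mvfderiv (𝓡 n) ξ x₀ X)) := by
  have hiff (x : M) := α.le_finrank_ker_sharp_iff hα x (p := m - 1) (by omega)
  refine ⟨forall_congr' hiff, fun hker x₀ ξ => ?_⟩
  rintro ⟨⟨U, hU, hxU, hξ, hle⟩, heq⟩
  have h0 (x : M) := (hiff x).1 (hker x)
  -- both assertions follow from their diagonal cases by polarization
  refine ⟨fun X v hv w hw => ?_, fun hpos X v hv w hw => ?_⟩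
  · have hself : ∀ u ∈ LinearMap.ker (α.sharp x₀), α.nabla cov x₀ u u X = 0 := fun u hu =>
      α.nabla_self_eq_zero hα cov (fun z => by
        rw [α.form_eq_of_mem_eigenspace (μ := 0) (by rwa [Module.End.eigenspace_zero]), zero_mul]) X
    have h := hself _ (add_mem hv hw)
    rw [α.nabla_add_add, hself v hv, hself w hw] at h
    linarith
  · have hsub (y : M) : α.subtrace m y = α.eigenvalue y ⟨m - 1, by omega⟩ :=
      α.subtrace_eq_eigenvalue (Nat.sub_add_cancel hm) fun k hk => h0 y k hk
    have hself : ∀ u ∈ Module.End.eigenspace (α.sharp x₀) (α.eigenvalue x₀ ⟨m - 1, by omega⟩),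
        α.nabla cov x₀ u u X = inner ℝ u u * mvfderiv (𝓡 n) ξ x₀ X := fun u hu =>
      α.nabla_self_eq_of_mem_eigenspace hα hcov ⟨m - 1, by omega⟩
      (fun y k hk => h0 y k hk) ((hξ.contMDiffAt (hU.mem_nhds hxU)).mdifferentiableAt (by simp))
      (by
        filter_upwards [hU.mem_nhds hxU] with y hy
        exact (hle y hy).trans_eq (hsub y))
      (heq.trans (hsub x₀)) hpos hu X
    have h := hself _ (add_mem hv hw)
    rw [α.nabla_add_add, hself v hv, hself w hw, real_inner_add_add_self] at h
    linarith
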